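/- Let $n\ge 0$ and let $\mathrm{PO}_n$ be the monoid of all order-preserving partial functions on the chain $\{1<\dots<n\}$, that is, partial functions $t$ with $t(x)\le t(y)$ whenever $x\le y$ are in the domain of $t$, composed from right to left. The ordinary quiver of a finite-dimensional $\mathbb{C}$-algebra $A$ has as vertices the isomorphism classes of simple left $A$-modules, and $\dim_{\mathbb{C}}\operatorname{Ext}^1_A(N,N')$ arrows from (the class of) $N$ to (the class of) $N'$. The vertices of the ordinary quiver of the monoid algebra $\mathbb{C}\mathrm{PO}_n$ are in bijection with $\{0,\dots,n\}$, where the vertex $k$ is the class of the simple module whose apex is the $\mathscr{J}$-class of elements of rank $k$; that is, the elements $t\in\mathrm{PO}_n$ acting on it as zero are exactly those with $|\operatorname{im} t|<k$. Under this bijection, there are exactly $k$ arrows from $k+1$ to $k$ for each $k=0,\dots,n-1$, and there are no other arrows. -/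

import Mathlib

/-! ### The ordinary quiver of a finite-dimensional algebra -/

namespace OrdinaryQuiver

open CategoryTheory

/-- The simple left modules over a ring `A`. -/
abbrev SimpleModuleCat (A : Type) [Ring A] : Type 1 :=
  { M : ModuleCat.{0} A // IsSimpleModule A M }

/-- Two simple modules are identified when they are isomorphic as `A`-modules. -/
instance isoSetoid (A : Type) [Ring A] : Setoid (SimpleModuleCat A) where
  r M N := Nonempty (M.1 ≅ N.1)
  iseqv := ⟨fun M => ⟨Iso.refl M.1⟩, fun ⟨e⟩ => ⟨e.symm⟩, fun ⟨e⟩ ⟨f⟩ => ⟨e ≪≫ f⟩⟩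

/-- The vertices of the ordinary quiver of `A`: isomorphism classes of simple left `A`-modules. -/
def Vertex (A : Type) [Ring A] : Type 1 := Quotient (isoSetoid A)

/-- The vertex given by a simple module. -/
def Vertex.mk {A : Type} [Ring A] (M : SimpleModuleCat A) : Vertex A :=
  Quotient.mk (isoSetoid A) M

/-- The dimension over `K` of `Ext¹_A(M, N)`, computed in the category of left `A`-modules. -/
noncomputable def extOneDim (K : Type) [Field K] {A : Type} [Ring A] [Algebra K A]
    (M N : ModuleCat.{0} A) : Cardinal.{0} :=
  Module.rank K (Abelian.Ext.{0} M N 1)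

/-- Isomorphic modules have `Ext¹` of the same dimension. -/
theorem extOneDim_congr (K : Type) [Field K] {A : Type} [Ring A] [Algebra K A]
    {M M' N N' : ModuleCat.{0} A} (e : M ≅ M') (f : N ≅ N') :
    extOneDim K M N = extOneDim K M' N' := by
  have h : ∀ {X X' Y Y' : ModuleCat.{0} A} (e : X ≅ X') (f : Y ≅ Y'),
      extOneDim K X Y ≤ extOneDim K X' Y' := by
    intro X X' Y Y' e f
    refine LinearMap.rank_le_of_injective
      (((Abelian.Ext.mk₀ f.hom).postcompOfLinear K X' (add_zero 1)).comp
        ((Abelian.Ext.mk₀ e.inv).precompOfLinear K Y (zero_add 1))) ?_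
    refine Function.LeftInverse.injective
      (g := (((Abelian.Ext.mk₀ f.inv).postcompOfLinear K X (add_zero 1)).comp
        ((Abelian.Ext.mk₀ e.hom).precompOfLinear K Y' (zero_add 1)))) ?_
    intro x
    simp [Abelian.Ext.mk₀_comp_mk₀_assoc]
  exact le_antisymm (h e f) (h e.symm f.symm)

/-- The number of arrows from `V` to `W` in the ordinary quiver of the `K`-algebra `A`:
the dimension of `Ext¹_A(M, N)` for simple modules `M`, `N` in the classes `V`, `W`. -/
noncomputable def numArrows (K : Type) [Field K] {A : Type} [Ring A] [Algebra K A]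
    (V W : Vertex A) : Cardinal.{0} :=
  Quotient.liftOn₂ V W (fun M N => extOneDim K M.1 N.1)
    (fun _ _ _ _ ⟨e⟩ ⟨f⟩ => extOneDim_congr K e f)

end OrdinaryQuiver

/-! ### The monoid of order-preserving partial functions -/

/-- Partial functions on an `n`-element chain. -/
def PartialTransf (n : ℕ) : Type := Fin n →. Fin n

namespace PartialTransf

/-- Composition of partial functions, from right to left: `(s * t) x = s (t x)`. -/
instance (n : ℕ) : Monoid (PartialTransf n) where
  mul s t := PFun.comp s t
  one := PFun.id (Fin n)
  mul_assoc s t u := PFun.comp_assoc s t u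
  one_mul t := PFun.id_comp t
  mul_one t := PFun.comp_id t

/-- The image of a partial function. -/
def image {n : ℕ} (t : PartialTransf n) : Set (Fin n) := PFun.ran t

/-- The rank of a partial function: the cardinality of its image. -/
noncomputable def rank {n : ℕ} (t : PartialTransf n) : ℕ := t.image.ncard

/-- `t` is order-preserving: `t x ≤ t y` whenever `x ≤ y` are in the domain of `t`. -/
def OrderPreserving {n : ℕ} (t : PartialTransf n) : Prop :=
  ∀ (x y : Fin n) (hx : (t x).Dom) (hy : (t y).Dom), x ≤ y → (t x).get hx ≤ (t y).get hy

end PartialTransf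

/-- The monoid of order-preserving partial functions on an `n`-element chain. -/
def PO (n : ℕ) : Submonoid (PartialTransf n) where
  carrier := { t | t.OrderPreserving }
  one_mem' := fun _ _ _ _ h => h
  mul_mem' := fun {_ _} hs ht x y hx hy h =>
    hs _ _ hx.2 hy.2 (ht x y hx.1 hy.1 h)

/-- The simple module `M` of the monoid algebra `ℂ[PO n]` has apex the class of elements of
rank `k`: exactly the elements of rank less than `k` act on `M` as zero. -/
def HasApexRank {n : ℕ} (M : OrdinaryQuiver.SimpleModuleCat (MonoidAlgebra ℂ (PO n)))
    (k : ℕ) : Prop :=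
  ∀ t : PO n, (∀ m : M.1, MonoidAlgebra.of ℂ (PO n) t • m = 0) ↔ t.1.rank < k

/-!
Strictly increasing `k`-tuples in the chain, i.e. `k`-element subsets, span a module `S_k`, on which
`t` sends a tuple `f` to `t ∘ f` if this is defined and strictly increasing, and to zero otherwise.
Partial identities isolate single basis vectors and the monoid moves any `k`-subset to any other, so
`S_k` is simple (`isSimpleModule_strict`); the elements killing it are those of rank less than `k`
(`strict_smul_eq_zero_iff`). If `M` is any simple module and `k` is the least rank of an element
acting on it nontrivially, a nonzero vector concentrated on `{0, ..., k - 1}` spreads to a nonzero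
map `S_k → M`, hence an isomorphism (`exists_equiv_strict`). This settles the vertices.

For the arrows, let `P_k` be spanned by all weakly increasing `k`-tuples, with `t ∘ f` read as zero
where it is undefined, and `R_k` by those with a repetition. Then `0 → R_k → P_k → S_k → 0` is exact,
and `P_k` is projective, being a direct summand of the algebra: inclusion-exclusion over domains gives
an `ε` fixing the initial tuple and killed by all `t` that are undefined somewhere on it
(`exists_killing_undefined`, `projective_mono`). Partial identities also show that a homomorphism
between such modules relates only tuples with the same range (`range_eq_of_coeff_ne_zero`).
Now `R_(k+1)` is generated by the `k` tuples `0, ..., q, q, ..., k - 1`, which have the range of the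
initial `k`-tuple. So `Hom(R_(k+1), S_l)` vanishes unless `l = k`, and for `l = k` a homomorphism is
determined by `k` scalars; these can be prescribed arbitrarily (`exists_collapse`), since two places of
repetition are never mixed by the action without a drop in rank. As `Hom(P_(k+1), S_k) = 0`, the long
exact sequence identifies `Ext¹(S_k, S_l)` with `Hom(R_k, S_l)` in every case.
-/

/-! ### Elements of the monoid -/

namespace PO

variable {n k : ℕ}

theorem ext_mem {s t : PO n} (h : ∀ x z, z ∈ s.1 x ↔ z ∈ t.1 x) : s = t :=
  Subtype.ext (funext fun x => Part.ext (h x))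

theorem mem_mul {s t : PO n} {x z : Fin n} :
    z ∈ (s * t).1 x ↔ ∃ y ∈ t.1 x, z ∈ s.1 y :=
  Part.mem_bind_iff

theorem mem_one {x z : Fin n} : z ∈ (1 : PO n).1 x ↔ z = x :=
  Part.mem_some_iff

theorem le_of_mem (t : PO n) {x y u v : Fin n} (hu : u ∈ t.1 x) (hv : v ∈ t.1 y) (h : x ≤ y) :
    u ≤ v := by
  obtain ⟨hx, rfl⟩ := hu
  obtain ⟨hy, rfl⟩ := hv
  exact t.2 x y hx hy h

theorem mem_image {t : PO n} {y : Fin n} : y ∈ t.1.image ↔ ∃ x, y ∈ t.1 x :=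
  Iff.rfl

open scoped Classical in
/-- The element with domain the range of `f` which sends `f x` to `g x`. -/
noncomputable def transport (f g : Fin k → Fin n) (hf : StrictMono f) (hg : Monotone g) : PO n :=
  ⟨fun y => ⟨∃ x, f x = y, fun h => g h.choose⟩, fun x y hx hy h => by
    refine hg (hf.le_iff_le.1 ?_)
    rw [hx.choose_spec, hy.choose_spec]
    exact h⟩

theorem mem_transport {f g : Fin k → Fin n} {hf : StrictMono f} {hg : Monotone g} {y z : Fin n} :
    z ∈ (transport f g hf hg).1 y ↔ ∃ x, f x = y ∧ g x = z := by
  constructor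
  · rintro ⟨h, rfl⟩
    exact ⟨h.choose, h.choose_spec, rfl⟩
  · rintro ⟨x, rfl, rfl⟩
    have h : ∃ x', f x' = f x := ⟨x, rfl⟩
    exact ⟨h, congrArg g (hf.injective h.choose_spec)⟩

theorem mul_transport {f g h : Fin k → Fin n} {hf : StrictMono f} {hg : Monotone g}
    (hh : Monotone h) {t : PO n} (ht : ∀ x, h x ∈ t.1 (g x)) :
    t * transport f g hf hg = transport f h hf hh := by
  refine ext_mem fun y z => ?_
  simp only [mem_mul, mem_transport]
  constructor
  · rintro ⟨_, ⟨x, rfl, rfl⟩, hz⟩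
    exact ⟨x, rfl, Part.mem_unique (ht x) hz⟩
  · rintro ⟨x, rfl, rfl⟩
    exact ⟨_, ⟨x, rfl, rfl⟩, ht x⟩

/-- The partial identity with domain `Y`. -/
noncomputable def idOn (Y : Set (Fin n)) : PO n :=
  ⟨fun y => ⟨y ∈ Y, fun _ => y⟩, fun _ _ _ _ h => h⟩

theorem mem_idOn {Y : Set (Fin n)} {y z : Fin n} : z ∈ (idOn Y).1 y ↔ y ∈ Y ∧ z = y :=
  ⟨fun ⟨h, e⟩ => ⟨h, e.symm⟩, fun ⟨h, e⟩ => ⟨h, e.symm⟩⟩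

/-- The rank of `t` is the length of the longest strictly increasing tuple that `t` sends to a
strictly increasing tuple. -/
theorem le_rank_iff {t : PO n} :
    k ≤ t.1.rank ↔ ∃ f g : Fin k → Fin n, StrictMono f ∧ StrictMono g ∧ ∀ x, g x ∈ t.1 (f x) := by
  classical
  constructor
  · intro h
    have hfin : t.1.image.Finite := Set.toFinite _
    rw [PartialTransf.rank, Set.ncard_eq_toFinset_card _ hfin] at h
    obtain ⟨s, hs, hk⟩ := Finset.exists_subset_card_eq h
    have hg : ∀ x, ∃ y, s.orderEmbOfFin hk x ∈ t.1 y := fun x => by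
      simpa [mem_image] using hs (s.orderEmbOfFin_mem hk x)
    choose f hf using hg
    refine ⟨f, s.orderEmbOfFin hk, fun x y hxy => ?_, (s.orderEmbOfFin hk).strictMono, hf⟩
    by_contra hle
    exact absurd (le_of_mem t (hf y) (hf x) (not_lt.1 hle))
      (not_le.2 ((s.orderEmbOfFin hk).strictMono hxy))
  · rintro ⟨f, g, -, hg, h⟩
    have hsub : Set.range g ⊆ t.1.image := by
      rintro _ ⟨x, rfl⟩
      exact ⟨f x, h x⟩
    have := Set.ncard_le_ncard hsub (Set.toFinite _)
    rwa [Set.ncard_range_of_injective hg.injective, Nat.card_eq_fintype_card,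
      Fintype.card_fin] at this

end PO

theorem StrictMono.eq_of_range_subset {n k : ℕ} {f g : Fin k → Fin n} (hf : StrictMono f)
    (hg : StrictMono g) (h : Set.range f ⊆ Set.range g) : f = g := by
  refine (StrictMono.range_inj hf hg).1 (Set.eq_of_subset_of_ncard_le h ?_)
  rw [Set.ncard_range_of_injective hf.injective, Set.ncard_range_of_injective hg.injective]

/-! ### Modules spanned by tuples -/

/-- A class of `k`-tuples in the chain which is closed under intermediate tuples: if
`f`, `t ∘ f` and `s ∘ t ∘ f` are given and the two outer ones belong to the class, so does the
middle one. This is what makes `TupleClass.Mod` below a module. -/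
structure TupleClass (n k : ℕ) where
  /-- The tuples in the class. -/
  Mem : (Fin k → Fin n) → Prop
  mem_of_mem : ∀ {f g h : Fin k → Fin n} (t s : PO n), Mem f → Mem h →
    (∀ x, g x ∈ t.1 (f x)) → (∀ x, h x ∈ s.1 (g x)) → Mem g

namespace TupleClass

variable {n k : ℕ} (C : TupleClass n k)

/-- The tuples in a class, as a type. -/
abbrev Elt : Type := { f : Fin k → Fin n // C.Mem f }

/-- `t ∘ f = g`; in particular the range of `f` lies in the domain of `t`. -/
def Maps {C : TupleClass n k} (t : PO n) (f g : C.Elt) : Prop := ∀ x, g.1 x ∈ t.1 (f.1 x)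

variable {C}

theorem Maps.unique {t : PO n} {f g g' : C.Elt} (h : Maps t f g) (h' : Maps t f g') : g = g' :=
  Subtype.ext (funext fun x => Part.mem_unique (h x) (h' x))

theorem maps_one {f g : C.Elt} : Maps 1 f g ↔ g = f := by
  simp only [Maps, PO.mem_one]
  exact ⟨fun h => Subtype.ext (funext h), fun h x => by rw [h]⟩

theorem maps_mul {s t : PO n} {f h : C.Elt} :
    Maps (s * t) f h ↔ ∃ g, Maps t f g ∧ Maps s g h := by
  constructor
  · intro H
    choose g hg hs using fun x => PO.mem_mul.1 (H x)
    exact ⟨⟨g, C.mem_of_mem t s f.2 h.2 hg hs⟩, hg, hs⟩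
  · rintro ⟨g, hg, hs⟩ x
    exact PO.mem_mul.2 ⟨_, hg x, hs x⟩

variable (C)

/-- The complex vector space spanned by the tuples of a class. -/
def Mod : Type := C.Elt →₀ ℂ

noncomputable instance : AddCommGroup C.Mod := inferInstanceAs (AddCommGroup (C.Elt →₀ ℂ))

noncomputable instance : Module ℂ C.Mod := inferInstanceAs (Module ℂ (C.Elt →₀ ℂ))

/-- The basis vector of `C.Mod` given by a tuple. -/
noncomputable def basisVec (f : C.Elt) : C.Mod := Finsupp.single f (1 : ℂ)

/-- The coefficient of a vector at a tuple. -/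
noncomputable def coeff (f : C.Elt) : C.Mod →ₗ[ℂ] ℂ := Finsupp.lapply f

variable {C}

open scoped Classical in
theorem coeff_basisVec (f g : C.Elt) : C.coeff f (C.basisVec g) = if g = f then 1 else 0 :=
  Finsupp.single_apply

theorem ext_coeff {v w : C.Mod} (h : ∀ f, C.coeff f v = C.coeff f w) : v = w :=
  Finsupp.ext h

theorem hom_ext {M : Type*} [AddCommMonoid M] [Module ℂ M] {φ ψ : C.Mod →ₗ[ℂ] M}
    (h : ∀ f, φ (C.basisVec f) = ψ (C.basisVec f)) : φ = ψ :=
  Finsupp.lhom_ext' fun f => LinearMap.ext_ring (h f)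

open scoped Classical in
/-- The image of a basis vector under an element of the monoid: `t ∘ f` if this is defined and
belongs to the class, and zero otherwise. -/
noncomputable def actVec (t : PO n) (f : C.Elt) : C.Mod :=
  if h : ∃ g, Maps t f g then C.basisVec h.choose else 0

theorem actVec_of_maps {t : PO n} {f g : C.Elt} (h : Maps t f g) :
    actVec t f = C.basisVec g := by
  have h' : ∃ g, Maps t f g := ⟨g, h⟩
  rw [actVec, dif_pos h', h'.choose_spec.unique h]

theorem actVec_of_not {t : PO n} {f : C.Elt} (h : ¬ ∃ g, Maps t f g) : actVec t f = 0 :=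
  dif_neg h

variable (C)

/-- The linear action of an element of the monoid. -/
noncomputable def actLin (t : PO n) : C.Mod →ₗ[ℂ] C.Mod :=
  Finsupp.linearCombination ℂ (actVec t)

variable {C}

theorem actLin_basisVec (t : PO n) (f : C.Elt) : C.actLin t (C.basisVec f) = actVec t f :=
  (Finsupp.linearCombination_single ℂ _ _).trans (one_smul ℂ _)

variable (C)

/-- The action of the monoid on `C.Mod`. -/
noncomputable def actHom : PO n →* Module.End ℂ C.Mod where
  toFun := C.actLin
  map_one' := hom_ext fun f => by
    rw [actLin_basisVec, actVec_of_maps (maps_one.2 rfl)]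
    rfl
  map_mul' s t := hom_ext fun f => by
    rw [Module.End.mul_apply, actLin_basisVec, actLin_basisVec]
    by_cases ht : ∃ g, Maps t f g
    · obtain ⟨g, hg⟩ := ht
      rw [actVec_of_maps hg, actLin_basisVec]
      by_cases hs : ∃ h, Maps s g h
      · obtain ⟨h, hh⟩ := hs
        rw [actVec_of_maps hh, actVec_of_maps (maps_mul.2 ⟨g, hg, hh⟩)]
      · rw [actVec_of_not hs, actVec_of_not]
        rintro ⟨h, hh⟩
        obtain ⟨g', hg', hh'⟩ := maps_mul.1 hh
        exact hs ⟨h, hg.unique hg' ▸ hh'⟩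
    · rw [actVec_of_not ht, map_zero, actVec_of_not]
      rintro ⟨h, hh⟩
      obtain ⟨g, hg, -⟩ := maps_mul.1 hh
      exact ht ⟨g, hg⟩

noncomputable instance : Module (MonoidAlgebra ℂ (PO n)) C.Mod :=
  Module.compHom C.Mod (MonoidAlgebra.lift ℂ (Module.End ℂ C.Mod) (PO n) C.actHom).toRingHom

variable {C}

theorem of_smul (t : PO n) (v : C.Mod) : MonoidAlgebra.of ℂ (PO n) t • v = C.actLin t v :=
  congrArg (fun φ : Module.End ℂ C.Mod => φ v) (MonoidAlgebra.lift_of C.actHom t)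

theorem algebraMap_smul' (c : ℂ) (v : C.Mod) :
    algebraMap ℂ (MonoidAlgebra ℂ (PO n)) c • v = c • v :=
  congrArg (fun φ : Module.End ℂ C.Mod => φ v)
    ((MonoidAlgebra.lift ℂ (Module.End ℂ C.Mod) (PO n) C.actHom).commutes c)

instance : IsScalarTower ℂ (MonoidAlgebra ℂ (PO n)) C.Mod :=
  IsScalarTower.of_algebraMap_smul algebraMap_smul'

theorem of_smul_basisVec {t : PO n} {f g : C.Elt} (h : Maps t f g) :
    MonoidAlgebra.of ℂ (PO n) t • C.basisVec f = C.basisVec g := by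
  rw [of_smul, actLin_basisVec, actVec_of_maps h]

theorem of_smul_basisVec_eq_zero {t : PO n} {f : C.Elt} (h : ¬ ∃ g, Maps t f g) :
    MonoidAlgebra.of ℂ (PO n) t • C.basisVec f = 0 := by
  rw [of_smul, actLin_basisVec, actVec_of_not h]

theorem basisVec_ne_zero (f : C.Elt) : C.basisVec f ≠ 0 :=
  Finsupp.single_ne_zero.2 one_ne_zero

theorem algHom_ext {M : Type*} [AddCommGroup M] [Module (MonoidAlgebra ℂ (PO n)) M]
    {φ ψ : C.Mod →ₗ[MonoidAlgebra ℂ (PO n)] M}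
    (h : ∀ f, φ (C.basisVec f) = ψ (C.basisVec f)) : φ = ψ := by
  let _ : Module ℂ M := Module.restrictScalars ℂ (MonoidAlgebra ℂ (PO n)) M
  have : IsScalarTower ℂ (MonoidAlgebra ℂ (PO n)) M := IsScalarTower.restrictScalars _ _ _
  have := hom_ext (φ := φ.restrictScalars ℂ) (ψ := ψ.restrictScalars ℂ) h
  exact LinearMap.ext fun v => LinearMap.congr_fun this v

/-- A map out of `C.Mod` is a family of vectors indexed by the tuples on which the monoid acts by
the same rule as on the basis. -/
theorem exists_lift {M : Type*} [AddCommGroup M] [Module (MonoidAlgebra ℂ (PO n)) M]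
    (F : C.Elt → M)
    (h₁ : ∀ t f g, Maps t f g → MonoidAlgebra.of ℂ (PO n) t • F f = F g)
    (h₂ : ∀ t f, (¬ ∃ g, Maps t f g) → MonoidAlgebra.of ℂ (PO n) t • F f = 0) :
    ∃ φ : C.Mod →ₗ[MonoidAlgebra ℂ (PO n)] M, ∀ f, φ (C.basisVec f) = F f := by
  let _ : Module ℂ M := Module.restrictScalars ℂ (MonoidAlgebra ℂ (PO n)) M
  have : IsScalarTower ℂ (MonoidAlgebra ℂ (PO n)) M := IsScalarTower.restrictScalars _ _ _
  let φ₀ : C.Mod →ₗ[ℂ] M := Finsupp.linearCombination ℂ F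
  have hφ₀ : ∀ f, φ₀ (C.basisVec f) = F f := fun f =>
    (Finsupp.linearCombination_single ℂ _ _).trans (one_smul ℂ _)
  have key : ∀ (t : PO n) (v : C.Mod),
      φ₀ (MonoidAlgebra.of ℂ (PO n) t • v) = MonoidAlgebra.of ℂ (PO n) t • φ₀ v := by
    intro t v
    simp only [of_smul]
    refine LinearMap.congr_fun (f := φ₀ ∘ₗ C.actLin t)
      (g := (Algebra.lsmul ℂ ℂ M (MonoidAlgebra.of ℂ (PO n) t)) ∘ₗ φ₀) (hom_ext fun f => ?_) v
    simp only [LinearMap.comp_apply, Algebra.lsmul_coe, hφ₀, actLin_basisVec]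
    by_cases h : ∃ g, Maps t f g
    · obtain ⟨g, hg⟩ := h
      rw [actVec_of_maps hg, hφ₀, h₁ t f g hg]
    · rw [actVec_of_not h, map_zero, h₂ t f h]
  have all : ∀ (a : MonoidAlgebra ℂ (PO n)) (v : C.Mod), φ₀ (a • v) = a • φ₀ v := fun a v => by
    induction a using MonoidAlgebra.induction_on with
    | of t => exact key t v
    | add a b ha hb => rw [add_smul, map_add, ha, hb, add_smul]
    | smul c a ha => rw [smul_assoc, map_smul, ha, smul_assoc]
  exact ⟨{ φ₀ with map_smul' := all }, hφ₀⟩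

open scoped Classical in
/-- A partial identity cuts a vector down to the tuples with values in its domain. -/
theorem coeff_idOn_smul (Y : Set (Fin n)) (v : C.Mod) (f : C.Elt) :
    C.coeff f (MonoidAlgebra.of ℂ (PO n) (PO.idOn Y) • v) =
      if Set.range f.1 ⊆ Y then C.coeff f v else 0 := by
  have hm : ∀ g g' : C.Elt, Maps (PO.idOn Y) g g' ↔ Set.range g.1 ⊆ Y ∧ g' = g := by
    intro g g'
    simp only [Maps, PO.mem_idOn, forall_and, Set.range_subset_iff]
    exact and_congr_right fun _ =>
      ⟨fun h => Subtype.ext (funext h), fun h x => by rw [h]⟩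
  rw [of_smul]
  split_ifs with hf
  · refine LinearMap.congr_fun (f := C.coeff f ∘ₗ C.actLin _) (hom_ext fun g => ?_) v
    rw [LinearMap.comp_apply, actLin_basisVec]
    by_cases hg : Set.range g.1 ⊆ Y
    · rw [actVec_of_maps ((hm g g).2 ⟨hg, rfl⟩)]
    · rw [actVec_of_not fun ⟨g', h⟩ => hg ((hm _ _).1 h).1, map_zero, coeff_basisVec, if_neg]
      rintro rfl
      exact hg hf
  · refine LinearMap.congr_fun (f := C.coeff f ∘ₗ C.actLin _) (g := 0) (hom_ext fun g => ?_) v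
    rw [LinearMap.comp_apply, actLin_basisVec, LinearMap.zero_apply]
    by_cases hg : Set.range g.1 ⊆ Y
    · rw [actVec_of_maps ((hm g g).2 ⟨hg, rfl⟩), coeff_basisVec, if_neg]
      rintro rfl
      exact hf hg
    · rw [actVec_of_not fun ⟨g', h⟩ => hg ((hm _ _).1 h).1, map_zero]

theorem idOn_smul_basisVec (f : C.Elt) :
    MonoidAlgebra.of ℂ (PO n) (PO.idOn (Set.range f.1)) • C.basisVec f = C.basisVec f :=
  of_smul_basisVec fun x => PO.mem_idOn.2 ⟨⟨x, rfl⟩, rfl⟩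

/-- Module homomorphisms can only relate tuples with the same range. -/
theorem range_eq_of_coeff_ne_zero {l : ℕ} {D : TupleClass n l}
    (φ : C.Mod →ₗ[MonoidAlgebra ℂ (PO n)] D.Mod) (g : C.Elt) (f : D.Elt)
    (h : D.coeff f (φ (C.basisVec g)) ≠ 0) : Set.range f.1 = Set.range g.1 := by
  classical
  apply Set.Subset.antisymm
  · by_contra hn
    apply h
    rw [← idOn_smul_basisVec, map_smul, coeff_idOn_smul, if_neg hn]
  · by_contra hn
    apply h
    have := coeff_idOn_smul (Set.range f.1) (φ (C.basisVec g)) f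
    rw [if_pos subset_rfl, ← map_smul, of_smul_basisVec_eq_zero, map_zero, map_zero] at this
    · exact this.symm
    · rintro ⟨g', hg'⟩
      refine hn ?_
      rintro _ ⟨x, rfl⟩
      exact (PO.mem_idOn.1 (hg' x)).1

end TupleClass

/-! ### Monotone, injective and degenerate tuples -/

namespace TupleClass

variable {n k : ℕ}

theorem mem_of_coeff {C : TupleClass n k} (N : Submodule (MonoidAlgebra ℂ (PO n)) C.Mod)
    (v : C.Mod) (h : ∀ f, C.coeff f v ≠ 0 → C.basisVec f ∈ N) : v ∈ N := by
  have hv : v = Finsupp.sum v fun f c => c • C.basisVec f := by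
    conv_lhs => rw [← Finsupp.sum_single (f := v)]
    refine Finsupp.sum_congr fun f _ => ?_
    exact (Finsupp.smul_single_one f _).symm
  rw [hv]
  refine sum_mem fun f hf => ?_
  have := N.smul_mem (algebraMap ℂ _ (C.coeff f v)) (h f (Finsupp.mem_support_iff.1 hf))
  rwa [algebraMap_smul'] at this

theorem exists_coeff_ne_zero {C : TupleClass n k} {v : C.Mod} (h : v ≠ 0) :
    ∃ f, C.coeff f v ≠ 0 := by
  by_contra! H
  exact h (ext_coeff fun f => by rw [H f, map_zero])

variable (n k)

/-- All weakly increasing tuples; for `k ≤ n` they span the projective cover of a simple module. -/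
abbrev mono : TupleClass n k where
  Mem f := Monotone f
  mem_of_mem t _ hf _ hg _ x y hxy := PO.le_of_mem t (hg x) (hg y) (hf hxy)

/-- The strictly increasing tuples, that is, the `k`-element subsets of the chain; they span a
simple module. -/
abbrev strict : TupleClass n k where
  Mem f := StrictMono f
  mem_of_mem _ s _ hh _ hs x y hxy := by
    by_contra hle
    exact absurd (PO.le_of_mem s (hs y) (hs x) (not_lt.1 hle)) (not_le.2 (hh hxy))

/-- The weakly increasing tuples with a repetition; they span the radical of the module of all
weakly increasing tuples. -/
abbrev degen : TupleClass n k where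
  Mem f := Monotone f ∧ ¬ Function.Injective f
  mem_of_mem t _ hf _ hg _ := by
    refine ⟨(mono n k).mem_of_mem t 1 hf.1 ?_ hg fun x => PO.mem_one.2 rfl, fun hi => hf.2 ?_⟩
    · exact fun x y hxy => PO.le_of_mem t (hg x) (hg y) (hf.1 hxy)
    · exact fun x y hxy => hi (Part.mem_unique (hg x) (hxy ▸ hg y))

variable {n k}

/-- The tuple `0 < 1 < ... < k - 1`. -/
def initial (h : k ≤ n) : (strict n k).Elt := ⟨Fin.castLE h, Fin.strictMono_castLE h⟩

/-- A strictly increasing tuple is weakly increasing. -/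
def strictToMono (f : (strict n k).Elt) : (mono n k).Elt := ⟨f.1, StrictMono.monotone f.2⟩

/-- A degenerate tuple is weakly increasing. -/
def degenToMono (f : (degen n k).Elt) : (mono n k).Elt := ⟨f.1, f.2.1⟩

theorem strict_eq_of_range_subset {f g : (strict n k).Elt} (h : Set.range f.1 ⊆ Set.range g.1) :
    f = g :=
  Subtype.ext (StrictMono.eq_of_range_subset f.2 g.2 h)

theorem maps_of_forall_dom {t : PO n} {f : (mono n k).Elt} (h : ∀ x, (t.1 (f.1 x)).Dom) :
    ∃ g, Maps t f g :=
  ⟨⟨fun x => (t.1 (f.1 x)).get (h x), fun _ _ hxy =>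
    PO.le_of_mem t (Part.get_mem _) (Part.get_mem _) (f.2 hxy)⟩, fun _ => Part.get_mem _⟩

variable (n k)

theorem exists_incl : ∃ φ : (degen n k).Mod →ₗ[MonoidAlgebra ℂ (PO n)] (mono n k).Mod,
    ∀ f, φ ((degen n k).basisVec f) = (mono n k).basisVec (degenToMono f) := by
  refine exists_lift _ (fun t f g h => of_smul_basisVec h)
    (fun t f h => of_smul_basisVec_eq_zero ?_)
  rintro ⟨g, hg⟩
  exact h ⟨⟨g.1, (degen n k).mem_of_mem t 1 f.2 ⟨g.2, fun hi => f.2.2 fun x y hxy =>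
    hi (Part.mem_unique (hg x) (by have := hg y; rwa [degenToMono, ← hxy] at this))⟩ hg
      fun x => PO.mem_one.2 rfl⟩, hg⟩

open scoped Classical in
theorem exists_proj : ∃ φ : (mono n k).Mod →ₗ[MonoidAlgebra ℂ (PO n)] (strict n k).Mod,
    ∀ f, φ ((mono n k).basisVec f) =
      if h : StrictMono f.1 then (strict n k).basisVec ⟨f.1, h⟩ else 0 := by
  refine exists_lift _ (fun t f g h => ?_) (fun t f h => ?_)
  · by_cases hf : StrictMono f.1
    · rw [dif_pos hf]
      split_ifs with hg
      · exact of_smul_basisVec h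
      · refine of_smul_basisVec_eq_zero ?_
        rintro ⟨g', hg'⟩
        apply hg
        have : g'.1 = g.1 := funext fun x => Part.mem_unique (hg' x) (h x)
        exact this ▸ g'.2
    · rw [dif_neg hf, dif_neg, smul_zero]
      exact fun hg => hf (f.2.strictMono_of_injective fun x y hxy =>
        hg.injective (Part.mem_unique (h x) (hxy ▸ h y)))
  · split_ifs with hf
    · refine of_smul_basisVec_eq_zero ?_
      rintro ⟨g, hg⟩
      exact h ⟨strictToMono g, hg⟩
    · exact smul_zero _

/-- The inclusion of the span of the degenerate tuples. -/
noncomputable def incl : (degen n k).Mod →ₗ[MonoidAlgebra ℂ (PO n)] (mono n k).Mod :=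
  (exists_incl n k).choose

/-- The map that kills the degenerate tuples. -/
noncomputable def proj : (mono n k).Mod →ₗ[MonoidAlgebra ℂ (PO n)] (strict n k).Mod :=
  (exists_proj n k).choose

variable {n k}

theorem incl_basisVec (f : (degen n k).Elt) :
    incl n k ((degen n k).basisVec f) = (mono n k).basisVec (degenToMono f) :=
  (exists_incl n k).choose_spec f

theorem proj_basisVec_strict (f : (strict n k).Elt) :
    proj n k ((mono n k).basisVec (strictToMono f)) = (strict n k).basisVec f :=
  ((exists_proj n k).choose_spec _).trans (dif_pos f.2)

theorem proj_basisVec_degen (f : (degen n k).Elt) :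
    proj n k ((mono n k).basisVec (degenToMono f)) = 0 :=
  ((exists_proj n k).choose_spec _).trans (dif_neg fun h => f.2.2 h.injective)

theorem mono_cases (f : (mono n k).Elt) :
    (∃ g, f = strictToMono g) ∨ ∃ g, f = degenToMono g := by
  by_cases h : Function.Injective f.1
  · exact .inl ⟨⟨f.1, Monotone.strictMono_of_injective f.2 h⟩, rfl⟩
  · exact .inr ⟨⟨f.1, f.2, h⟩, rfl⟩

theorem coeff_incl (v : (degen n k).Mod) (f : (degen n k).Elt) :
    (mono n k).coeff (degenToMono f) (incl n k v) = (degen n k).coeff f v := by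
  classical
  refine LinearMap.congr_fun
    (f := (mono n k).coeff (degenToMono f) ∘ₗ (incl n k).restrictScalars ℂ)
    (hom_ext fun g => ?_) v
  rw [LinearMap.comp_apply, LinearMap.restrictScalars_apply, incl_basisVec, coeff_basisVec,
    coeff_basisVec]
  exact if_congr
    ⟨fun h => Subtype.ext (congrArg (fun u : (mono n k).Elt => u.1) h), fun h => h ▸ rfl⟩ rfl rfl

theorem coeff_proj (v : (mono n k).Mod) (f : (strict n k).Elt) :
    (strict n k).coeff f (proj n k v) = (mono n k).coeff (strictToMono f) v := by
  classical
  refine LinearMap.congr_fun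
    (f := (strict n k).coeff f ∘ₗ (proj n k).restrictScalars ℂ)
    (hom_ext fun g => ?_) v
  rw [LinearMap.comp_apply, LinearMap.restrictScalars_apply]
  obtain ⟨g, rfl⟩ | ⟨g, rfl⟩ := mono_cases g
  · rw [proj_basisVec_strict, coeff_basisVec, coeff_basisVec]
    exact if_congr
      ⟨fun h => h ▸ rfl, fun h => Subtype.ext (congrArg (fun u : (mono n k).Elt => u.1) h)⟩ rfl rfl
  · rw [proj_basisVec_degen, coeff_basisVec, if_neg, map_zero]
    intro h
    apply g.2.2
    have : g.1 = f.1 := congrArg Subtype.val h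
    exact this ▸ StrictMono.injective f.2

theorem incl_injective : Function.Injective (incl n k) := fun v w h =>
  ext_coeff fun f => by rw [← coeff_incl, h, coeff_incl]

theorem proj_surjective : Function.Surjective (proj n k) := by
  rw [← LinearMap.range_eq_top, eq_top_iff]
  exact fun v _ => mem_of_coeff _ v fun f _ => ⟨_, proj_basisVec_strict f⟩

theorem exact_incl_proj : Function.Exact (incl n k) (proj n k) := by
  rw [LinearMap.exact_iff]
  apply le_antisymm
  · refine fun v hv => mem_of_coeff _ v fun f hf => ?_
    obtain ⟨g, rfl⟩ | ⟨g, rfl⟩ := mono_cases f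
    · rw [← coeff_proj, LinearMap.mem_ker.1 hv, map_zero] at hf
      exact absurd rfl hf
    · exact ⟨_, incl_basisVec g⟩
  · rw [LinearMap.range_le_ker_iff]
    exact algHom_ext fun f => by
      rw [LinearMap.comp_apply, incl_basisVec, proj_basisVec_degen, LinearMap.zero_apply]

/-! ### Projectivity -/

/-- There is an element of the algebra that is killed from the left by every `t` which is undefined
somewhere on `Y`, and which fixes every tuple that visits all of `Y`. For `Y = {y}` this is
`1 - e`, where `e` is the identity on the complement of `y`; in general it is a product of
such elements. -/
theorem exists_killing_undefined (Y : Finset (Fin n)) : ∃ ε : MonoidAlgebra ℂ (PO n),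
    (∀ t : PO n, (∃ y ∈ Y, ¬ (t.1 y).Dom) → MonoidAlgebra.of ℂ (PO n) t * ε = 0) ∧
    ∀ f : (mono n k).Elt, ↑Y ⊆ Set.range f.1 →
      ε • (mono n k).basisVec f = (mono n k).basisVec f := by
  classical
  induction Y using Finset.induction_on with
  | empty => exact ⟨1, by simp, fun f _ => one_smul _ _⟩
  | insert y Y _ ih =>
    obtain ⟨ε, h₁, h₂⟩ := ih
    have hdom : ∀ (t : PO n) (z : Fin n), ¬ (t.1 z).Dom →
        ¬ ((t * PO.idOn {y}ᶜ).1 z).Dom := fun t z hz hd => by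
      obtain ⟨w, hw, hw'⟩ := PO.mem_mul.1 (Part.get_mem hd)
      rw [(PO.mem_idOn.1 hw).2] at hw'
      exact hz hw'.1
    refine ⟨(1 - MonoidAlgebra.of ℂ (PO n) (PO.idOn {y}ᶜ)) * ε, fun t ht => ?_, fun f hf => ?_⟩
    · rw [← mul_assoc, mul_sub, mul_one, ← map_mul, sub_mul]
      obtain ⟨z, hz, hzt⟩ := ht
      obtain rfl | hz := Finset.mem_insert.1 hz
      · rw [← sub_mul, show t * PO.idOn {z}ᶜ = t from PO.ext_mem fun x w => ?_, sub_self, zero_mul]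
        simp only [PO.mem_mul, PO.mem_idOn]
        constructor
        · rintro ⟨_, ⟨-, rfl⟩, h⟩
          exact h
        · refine fun h => ⟨x, ⟨?_, rfl⟩, h⟩
          rintro rfl
          exact hzt h.1
      · rw [h₁ t ⟨z, hz, hzt⟩, h₁ _ ⟨z, hz, hdom t z hzt⟩, sub_zero]
    · rw [Finset.coe_insert, Set.insert_subset_iff] at hf
      rw [mul_smul, h₂ f hf.2, sub_smul, one_smul, of_smul_basisVec_eq_zero, sub_zero]
      rintro ⟨g, hg⟩
      obtain ⟨x, hx⟩ := hf.1
      exact (PO.mem_idOn.1 (hg x)).1 hx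

/-- The module of all weakly increasing tuples is a direct summand of the regular module: it is
generated by the initial tuple. -/
theorem projective_mono (h : k ≤ n) :
    Module.Projective (MonoidAlgebra ℂ (PO n)) (mono n k).Mod := by
  obtain ⟨ε, h₁, h₂⟩ :=
    exists_killing_undefined (k := k) (Finset.univ.map ⟨(initial h).1, (initial h).2.injective⟩)
  have hmul : ∀ (t : PO n) (f g : (mono n k).Elt), Maps t f g →
      t * PO.transport _ f.1 (initial h).2 f.2 = PO.transport _ g.1 (initial h).2 g.2 :=
    fun t f g hfg => PO.mul_transport _ hfg
  obtain ⟨φ, hφ⟩ := exists_lift (C := mono n k) (fun f =>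
      MonoidAlgebra.of ℂ (PO n) (PO.transport _ f.1 (initial h).2 f.2) * ε)
    (fun t f g hfg => by rw [smul_eq_mul, ← mul_assoc, ← map_mul, hmul t f g hfg])
    (fun t f hf => by
      rw [smul_eq_mul, ← mul_assoc, ← map_mul]
      obtain ⟨x, hx⟩ := not_forall.1 (mt maps_of_forall_dom hf)
      refine h₁ _ ⟨(initial h).1 x, by simp, fun hd => hx ?_⟩
      obtain ⟨w, hw, hw'⟩ := PO.mem_mul.1 (Part.get_mem hd)
      obtain ⟨y, hy, rfl⟩ := PO.mem_transport.1 hw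
      rw [(initial h).2.injective hy] at hw'
      exact hw'.1)
  refine Module.Projective.of_split φ
    (LinearMap.toSpanSingleton _ _ ((mono n k).basisVec (strictToMono (initial h))))
    (algHom_ext fun f => ?_)
  rw [LinearMap.comp_apply, hφ, LinearMap.toSpanSingleton_apply, mul_smul, h₂, LinearMap.id_apply]
  · exact of_smul_basisVec fun x => PO.mem_transport.2 ⟨x, rfl, rfl⟩
  · intro y
    simp [strictToMono]

end TupleClass

/-! ### The simple modules -/

namespace TupleClass

variable {n k : ℕ}

theorem isSimpleModule_strict (h : k ≤ n) :
    IsSimpleModule (MonoidAlgebra ℂ (PO n)) (strict n k).Mod := by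
  have : Nontrivial (strict n k).Mod := ⟨_, _, basisVec_ne_zero (initial h)⟩
  refine isSimpleModule_iff _ _ |>.2
    { eq_bot_or_eq_top := fun N => or_iff_not_imp_left.2 fun hN => ?_ }
  obtain ⟨v, hvN, hv⟩ := N.ne_bot_iff.1 hN
  obtain ⟨f, hf⟩ := exists_coeff_ne_zero hv
  -- The identity on the range of `f` sends `v` to a nonzero multiple of the basis vector of `f`.
  have hproj : MonoidAlgebra.of ℂ (PO n) (PO.idOn (Set.range f.1)) • v =
      (strict n k).coeff f v • (strict n k).basisVec f := by
    classical
    refine ext_coeff fun g => ?_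
    rw [coeff_idOn_smul, map_smul, coeff_basisVec]
    by_cases hg : f = g
    · rw [if_pos hg, ← hg, if_pos subset_rfl, smul_eq_mul, mul_one]
    · rw [if_neg hg, if_neg fun hr => hg (strict_eq_of_range_subset hr).symm, smul_zero]
  have hfN : (strict n k).basisVec f ∈ N := by
    have h' := N.smul_mem (algebraMap ℂ _ ((strict n k).coeff f v)⁻¹)
      (N.smul_mem (MonoidAlgebra.of ℂ (PO n) (PO.idOn (Set.range f.1))) hvN)
    rwa [hproj, algebraMap_smul', inv_smul_smul₀ hf] at h'
  refine eq_top_iff.2 fun w _ => mem_of_coeff N w fun g _ => ?_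
  have hg : Maps (PO.transport f.1 g.1 f.2 (StrictMono.monotone g.2)) f g :=
    fun x => PO.mem_transport.2 ⟨x, rfl, rfl⟩
  rw [← of_smul_basisVec hg]
  exact N.smul_mem _ hfN

theorem strict_smul_eq_zero_iff (t : PO n) :
    (∀ v : (strict n k).Mod, MonoidAlgebra.of ℂ (PO n) t • v = 0) ↔ t.1.rank < k := by
  rw [← not_le, PO.le_rank_iff]
  constructor
  · rintro h ⟨f, g, hf, hg, hfg⟩
    have := of_smul_basisVec (C := strict n k) (f := ⟨f, hf⟩) (g := ⟨g, hg⟩) hfg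
    exact basisVec_ne_zero _ (this.symm.trans (h _))
  · intro h v
    rw [of_smul]
    refine LinearMap.congr_fun (g := 0) (hom_ext fun f => ?_) v
    rw [← of_smul, LinearMap.zero_apply]
    refine of_smul_basisVec_eq_zero ?_
    rintro ⟨g, hg⟩
    exact h ⟨f.1, g.1, f.2, g.2, hg⟩

/-- If `k` is minimal such that some element of rank `k` does not annihilate the simple
module, then the module is spanned by strictly increasing `k`-tuples. -/
theorem exists_equiv_strict (M : Type*) [AddCommGroup M] [Module (MonoidAlgebra ℂ (PO n)) M]
    [IsSimpleModule (MonoidAlgebra ℂ (PO n)) M] :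
    ∃ k ≤ n, Nonempty ((strict n k).Mod ≃ₗ[MonoidAlgebra ℂ (PO n)] M) := by
  classical
  have hex : ∃ k, ∃ t : PO n, t.1.rank = k ∧ ∃ m : M, MonoidAlgebra.of ℂ (PO n) t • m ≠ 0 := by
    have := IsSimpleModule.nontrivial (MonoidAlgebra ℂ (PO n)) M
    obtain ⟨m, hm⟩ := exists_ne (0 : M)
    exact ⟨_, 1, rfl, m, by rwa [map_one, one_smul]⟩
  obtain ⟨t, ht, m, hm⟩ := Nat.find_spec hex
  have hmin : ∀ s : PO n, s.1.rank < Nat.find hex → ∀ m : M,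
      MonoidAlgebra.of ℂ (PO n) s • m = 0 := fun s hs m => by
    by_contra h
    exact Nat.find_min hex hs ⟨s, rfl, m, h⟩
  generalize Nat.find hex = k at ht hmin
  obtain ⟨f, g, hf, hg, hfg⟩ := PO.le_rank_iff.1 ht.ge
  have hk : k ≤ n := by simpa using Fintype.card_le_of_injective f hf.injective
  refine ⟨k, hk, ?_⟩
  -- Since `t` has rank exactly `k`, its image is the range of `g`.
  have himage : ∀ x y, y ∈ t.1 x → y ∈ Set.range g := by
    have hsub : Set.range g ⊆ t.1.image := by
      rintro _ ⟨x, rfl⟩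
      exact ⟨f x, hfg x⟩
    have := Set.eq_of_subset_of_ncard_le hsub (by
      rw [Set.ncard_range_of_injective hg.injective, Nat.card_eq_fintype_card, Fintype.card_fin]
      exact ht.le) (Set.toFinite _)
    intro x y hxy
    rw [this]
    exact ⟨x, hxy⟩
  let ι := initial hk
  -- Transport `t • m` from the range of `t` to the initial segment.
  set m₀ : M := MonoidAlgebra.of ℂ (PO n) (PO.transport g ι.1 hg (StrictMono.monotone ι.2)) •
    MonoidAlgebra.of ℂ (PO n) t • m with hm₀
  have hm₀_ne : m₀ ≠ 0 := by
    intro h0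
    apply hm
    have : PO.transport ι.1 g ι.2 hg.monotone *
        (PO.transport g ι.1 hg (StrictMono.monotone ι.2) * t) = t := by
      rw [← mul_assoc, PO.mul_transport hg.monotone fun x => PO.mem_transport.2 ⟨x, rfl, rfl⟩]
      refine PO.ext_mem fun x z => ?_
      simp only [PO.mem_mul, PO.mem_transport]
      constructor
      · rintro ⟨_, hy, w, rfl, rfl⟩
        exact hy
      · intro hz
        obtain ⟨w, rfl⟩ := himage x z hz
        exact ⟨_, hz, w, rfl, rfl⟩
    rw [← this, map_mul, map_mul, mul_smul, mul_smul, ← hm₀, h0, smul_zero]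
  obtain ⟨φ, hφ⟩ := exists_lift (C := strict n k) (fun f =>
      MonoidAlgebra.of ℂ (PO n) (PO.transport ι.1 f.1 ι.2 (StrictMono.monotone f.2)) • m₀)
    (fun s f g hs => by
      rw [← mul_smul, ← map_mul, PO.mul_transport (StrictMono.monotone g.2) hs])
    (fun s f hs => by
      rw [← mul_smul, ← map_mul]
      -- If `s ∘ f` is not strictly increasing, `s` times the transport has rank below `k`.
      refine hmin _ (not_le.1 fun hle => hs ?_) _
      obtain ⟨u, v, hu, hv, huv⟩ := PO.le_rank_iff.1 hle
      have huι : (⟨u, hu⟩ : (strict n k).Elt) = ι := strict_eq_of_range_subset (by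
        rintro _ ⟨x, rfl⟩
        obtain ⟨_, hy, -⟩ := PO.mem_mul.1 (huv x)
        obtain ⟨w, hw, -⟩ := PO.mem_transport.1 hy
        exact ⟨w, hw⟩)
      refine ⟨⟨v, hv⟩, fun x => ?_⟩
      obtain ⟨_, hy, hz⟩ := PO.mem_mul.1 (huv x)
      obtain ⟨w, hw, rfl⟩ := PO.mem_transport.1 hy
      rw [← huι] at hw
      rwa [hu.injective hw] at hz)
  have := isSimpleModule_strict hk
  have hφ_ne : φ ≠ 0 := by
    rintro rfl
    apply hm₀_ne
    have h0 := hφ ι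
    rw [LinearMap.zero_apply, hm₀, ← mul_smul, ← map_mul,
      PO.mul_transport (StrictMono.monotone ι.2) fun x => PO.mem_transport.2 ⟨x, rfl, rfl⟩] at h0
    exact h0.symm
  exact ⟨LinearEquiv.ofBijective φ (LinearMap.bijective_of_ne_zero hφ_ne)⟩

/-! ### Homomorphisms out of the span of the degenerate tuples -/

/-- The degenerate tuple `0, ..., q, q, ..., k - 1` of length `k + 1`. -/
def repeatAt (h : k ≤ n) (q : Fin k) : (degen n (k + 1)).Elt :=
  ⟨fun x => (initial h).1 (q.predAbove x),
    fun _ _ hxy => StrictMono.monotone (initial h).2 (Fin.predAbove_right_monotone q hxy),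
    fun hi => q.castSucc_lt_succ.ne (hi (by simp))⟩

theorem range_repeatAt (h : k ≤ n) (q : Fin k) :
    Set.range (repeatAt h q).1 = Set.range (initial h).1 :=
  (Fin.predAbove_surjective q).range_comp (initial h).1

/-- A weakly increasing tuple with equal entries at `q` and `q + 1` comes from a shorter one. -/
theorem factor_predAbove {f : Fin (k + 1) → Fin n} {q : Fin k} (hq : f q.castSucc = f q.succ)
    (x : Fin (k + 1)) : f (q.castSucc.succAbove (q.predAbove x)) = f x := by
  by_cases hx : x = q.castSucc
  · subst hx
    simp [hq]
  · rw [Fin.succAbove_predAbove hx]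

theorem exists_eq_succ (f : (degen n (k + 1)).Elt) : ∃ q : Fin k, f.1 q.castSucc = f.1 q.succ := by
  by_contra! h
  exact f.2.2 (Fin.strictMono_iff_lt_succ.2 fun q =>
    lt_of_le_of_ne (f.2.1 q.castSucc_lt_succ.le) (h q)).injective

/-- The tuples `repeatAt h q` generate the span of the degenerate tuples. -/
theorem exists_maps_repeatAt (h : k ≤ n) (f : (degen n (k + 1)).Elt) :
    ∃ q t, Maps t (repeatAt h q) f := by
  obtain ⟨q, hq⟩ := exists_eq_succ f
  refine ⟨q, PO.transport (initial h).1 (fun y => f.1 (q.castSucc.succAbove y)) (initial h).2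
    fun x y hxy => f.2.1 ((Fin.strictMono_succAbove _).monotone hxy), fun x => ?_⟩
  exact PO.mem_transport.2 ⟨q.predAbove x, rfl, factor_predAbove hq x⟩

theorem degen_hom_ext (h : k ≤ n) {M : Type*} [AddCommGroup M]
    [Module (MonoidAlgebra ℂ (PO n)) M]
    {φ ψ : (degen n (k + 1)).Mod →ₗ[MonoidAlgebra ℂ (PO n)] M}
    (H : ∀ q, φ ((degen n (k + 1)).basisVec (repeatAt h q)) =
      ψ ((degen n (k + 1)).basisVec (repeatAt h q))) : φ = ψ :=
  algHom_ext fun f => by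
    obtain ⟨q, t, ht⟩ := exists_maps_repeatAt h f
    rw [← of_smul_basisVec ht, map_smul, map_smul, H]

theorem eq_of_range_eq {l : ℕ} {f : (strict n k).Elt} {g : (strict n l).Elt}
    (h : Set.range f.1 = Set.range g.1) : k = l := by
  simpa [Set.ncard_range_of_injective, StrictMono.injective f.2, StrictMono.injective g.2]
    using congrArg Set.ncard h

/-- There are no nonzero maps from the projective cover of one simple module to another one. -/
theorem mono_hom_eq_zero {l : ℕ} (h : k ≤ n) (hkl : k ≠ l)
    (φ : (mono n k).Mod →ₗ[MonoidAlgebra ℂ (PO n)] (strict n l).Mod) : φ = 0 := by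
  have h0 : φ ((mono n k).basisVec (strictToMono (initial h))) = 0 := by
    by_contra hne
    obtain ⟨f, hf⟩ := exists_coeff_ne_zero hne
    exact hkl (eq_of_range_eq (f := initial h) (range_eq_of_coeff_ne_zero φ _ f hf).symm)
  refine algHom_ext fun f => ?_
  have hf : Maps (PO.transport (initial h).1 f.1 (initial h).2 f.2)
      (strictToMono (initial h)) f := fun x => PO.mem_transport.2 ⟨x, rfl, rfl⟩
  rw [← of_smul_basisVec hf, map_smul, h0, smul_zero, LinearMap.zero_apply]

theorem degen_hom_eq_zero {l : ℕ} (h : k ≤ n) (hkl : k ≠ l + 1)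
    (φ : (degen n k).Mod →ₗ[MonoidAlgebra ℂ (PO n)] (strict n l).Mod) : φ = 0 := by
  cases k with
  | zero => exact algHom_ext fun f => absurd (Function.injective_of_subsingleton f.1) f.2.2
  | succ k =>
    refine degen_hom_ext (k.le_succ.trans h) fun q => ?_
    by_contra hne
    obtain ⟨f, hf⟩ := exists_coeff_ne_zero hne
    have := range_eq_of_coeff_ne_zero φ _ f hf
    rw [range_repeatAt] at this
    exact hkl (congrArg (· + 1) (eq_of_range_eq this).symm)

theorem apply_repeatAt (h : k ≤ n)
    (φ : (degen n (k + 1)).Mod →ₗ[MonoidAlgebra ℂ (PO n)] (strict n k).Mod) (q : Fin k) :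
    φ ((degen n (k + 1)).basisVec (repeatAt h q)) =
      (strict n k).coeff (initial h) (φ ((degen n (k + 1)).basisVec (repeatAt h q))) •
        (strict n k).basisVec (initial h) := by
  classical
  refine ext_coeff fun f => ?_
  rw [map_smul, coeff_basisVec]
  by_cases hf : initial h = f
  · rw [if_pos hf, ← hf, smul_eq_mul, mul_one]
  · rw [if_neg hf, smul_zero]
    by_contra hne
    have := range_eq_of_coeff_ne_zero φ _ f hne
    rw [range_repeatAt] at this
    exact hf (strict_eq_of_range_subset this.ge)

/-- The homomorphism that keeps the tuples with the single repetition at `q` and `q + 1`, removing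
the repeated entry, and kills all other degenerate tuples. -/
theorem exists_collapse (h : k ≤ n) (q : Fin k) :
    ∃ φ : (degen n (k + 1)).Mod →ₗ[MonoidAlgebra ℂ (PO n)] (strict n k).Mod,
      ∀ q', φ ((degen n (k + 1)).basisVec (repeatAt h q')) =
        if q' = q then (strict n k).basisVec (initial h) else 0 := by
  classical
  -- `Good f g`: the degenerate tuple `f` is `g` with its entry at `q` repeated.
  let Good (f : (degen n (k + 1)).Elt) (g : (strict n k).Elt) : Prop :=
    ∀ x, f.1 x = g.1 (q.predAbove x)
  have good_unique : ∀ {f g g'}, Good f g → Good f g' → g = g' := fun {f g g'} hg hg' => by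
    refine Subtype.ext (funext fun y => ?_)
    obtain ⟨x, rfl⟩ := Fin.predAbove_surjective q y
    exact (hg x).symm.trans (hg' x)
  let F (f : (degen n (k + 1)).Elt) : (strict n k).Mod :=
    if hf : ∃ g, Good f g then (strict n k).basisVec hf.choose else 0
  have hF : ∀ {f g}, Good f g → F f = (strict n k).basisVec g := fun {f g} hg => by
    have hf : ∃ g, Good f g := ⟨g, hg⟩
    simp only [F]
    rw [dif_pos hf, good_unique hf.choose_spec hg]
  have hF0 : ∀ {f}, (¬ ∃ g, Good f g) → F f = 0 := fun {f} hf => dif_neg hf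
  -- `Good` is preserved and reflected by the action.
  have good_of_maps : ∀ {t f f' g'}, Maps t f f' → Good f' g' →
      ∃ g, Good f g ∧ Maps t g g' := by
    intro t f f' g' ht hg'
    obtain ⟨p, hp⟩ := exists_eq_succ f
    -- `f'` inherits the repetition of `f`, and its only one is at `q`.
    have hpq : p = q := by
      have h1 : f'.1 p.castSucc = f'.1 p.succ :=
        Part.mem_unique (ht p.castSucc) (hp ▸ ht p.succ)
      rw [hg', hg'] at h1
      have h2 := StrictMono.injective g'.2 h1
      rcases lt_trichotomy p q with hlt | heq | hlt
      · rw [Fin.predAbove_castSucc_of_le _ _ hlt.le, Fin.predAbove_succ_of_lt _ _ hlt] at h2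
        simp [Fin.ext_iff] at h2
      · exact heq
      · rw [Fin.predAbove_castSucc_of_lt _ _ hlt, Fin.predAbove_succ_of_le _ _ hlt.le] at h2
        have := Fin.lt_def.1 hlt
        simp only [Fin.ext_iff, Fin.val_pred, Fin.val_castSucc] at h2
        omega
    subst hpq
    have hmaps : ∀ y, g'.1 y ∈ t.1 (f.1 (p.castSucc.succAbove y)) := fun y => by
      have := ht (p.castSucc.succAbove y)
      rwa [hg', Fin.predAbove_succAbove] at this
    have hmono : Monotone fun y => f.1 (p.castSucc.succAbove y) := fun x y hxy =>
      f.2.1 ((Fin.strictMono_succAbove _).monotone hxy)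
    exact ⟨⟨fun y => f.1 (p.castSucc.succAbove y), hmono.strictMono_of_injective fun x y hxy =>
      StrictMono.injective g'.2 (Part.mem_unique (hmaps x)
        ((show f.1 _ = f.1 _ from hxy) ▸ hmaps y))⟩,
      fun x => (factor_predAbove hp x).symm, hmaps⟩
  have good_maps : ∀ {t f f' g g'}, Maps t f f' → Good f g → Maps t g g' → Good f' g' := by
    intro t f f' g g' ht hg ht' x
    exact Part.mem_unique (ht x) (by rw [hg]; exact ht' _)
  obtain ⟨φ, hφ⟩ := exists_lift F
    (fun t f f' ht => by
      by_cases hf : ∃ g, Good f g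
      · obtain ⟨g, hg⟩ := hf
        rw [hF hg]
        by_cases hg' : ∃ g', Maps t g g'
        · obtain ⟨g', hg'⟩ := hg'
          rw [of_smul_basisVec hg', hF (good_maps ht hg hg')]
        · rw [of_smul_basisVec_eq_zero hg', hF0]
          rintro ⟨g', hf'⟩
          obtain ⟨g₁, h₁, h₂⟩ := good_of_maps ht hf'
          exact hg' ⟨g', good_unique h₁ hg ▸ h₂⟩
      · rw [hF0 hf, smul_zero, hF0]
        rintro ⟨g', hf'⟩
        obtain ⟨g₁, h₁, -⟩ := good_of_maps ht hf'
        exact hf ⟨g₁, h₁⟩)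
    (fun t f hf => by
      by_cases hf' : ∃ g, Good f g
      · obtain ⟨g, hg⟩ := hf'
        rw [hF hg]
        refine of_smul_basisVec_eq_zero ?_
        rintro ⟨g', hg'⟩
        have hmaps : ∀ x, g'.1 (q.predAbove x) ∈ t.1 (f.1 x) := fun x => by
          rw [hg]
          exact hg' _
        exact hf ⟨⟨fun x => g'.1 (q.predAbove x), fun x y hxy =>
          StrictMono.monotone g'.2 (Fin.predAbove_right_monotone q hxy),
          fun hi => q.castSucc_lt_succ.ne (hi (by simp))⟩, hmaps⟩
      · rw [hF0 hf', smul_zero])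
  refine ⟨φ, fun q' => ?_⟩
  rw [hφ]
  split_ifs with hq
  · subst hq
    exact hF fun x => rfl
  · refine hF0 ?_
    rintro ⟨g, hg⟩
    apply hq
    have hgι : g = initial h := by
      refine strict_eq_of_range_subset ?_
      rintro _ ⟨y, rfl⟩
      obtain ⟨x, rfl⟩ := Fin.predAbove_surjective q y
      exact ⟨q'.predAbove x, hg x⟩
    subst hgι
    exact Fin.predAbove_left_injective (funext fun x =>
      StrictMono.injective (initial h).2 (hg x))

end TupleClass

/-! ### Computation of the arrows -/

namespace OrdinaryQuiver

open CategoryTheory Abelian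

/-- If `0 → X₁ → X₂ → X₃ → 0` is exact with `X₂` projective, and no nonzero map `X₁ → Y` extends
to `X₂`, then the connecting map identifies `Hom(X₁, Y)` with `Ext¹(X₃, Y)`. -/
theorem extOneDim_eq_rank_hom (K : Type) [Field K] {A : Type} [Ring A] [Algebra K A]
    {S : ShortComplex (ModuleCat.{0} A)} (hS : S.ShortExact) [Projective S.X₂] (Y : ModuleCat.{0} A)
    (h : ∀ φ : S.X₂ ⟶ Y, S.f ≫ φ = 0) :
    extOneDim K S.X₃ Y = Module.rank K (S.X₁ ⟶ Y) := by
  refine (LinearEquiv.rank_eq ((Ext.linearEquiv₀ (R := K)).symm.trans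
    (LinearEquiv.ofBijective (hS.extClass.precompOfLinear K Y (add_zero 1)) ⟨?_, ?_⟩))).symm
  · rw [injective_iff_map_eq_zero]
    intro x hx
    obtain ⟨y, rfl⟩ := Ext.contravariant_sequence_exact₁ hS Y x (add_zero 1) hx
    obtain ⟨φ, rfl⟩ := Ext.addEquiv₀.symm.surjective y
    change (Ext.mk₀ S.f).comp (Ext.mk₀ φ) _ = 0
    rw [Ext.mk₀_comp_mk₀, h, Ext.mk₀_zero]
  · intro x
    exact Ext.contravariant_sequence_exact₃ hS Y x (Ext.eq_zero_of_projective _) (add_zero 1)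

end OrdinaryQuiver

namespace TupleClass

open CategoryTheory OrdinaryQuiver

variable {n k l : ℕ}

/-- The simple module with apex `k`, as an object. -/
noncomputable def simple (h : k ≤ n) : SimpleModuleCat (MonoidAlgebra ℂ (PO n)) :=
  ⟨ModuleCat.of _ (strict n k).Mod, isSimpleModule_strict h⟩

theorem hasApexRank_of_iso (h : k ≤ n) {M : SimpleModuleCat (MonoidAlgebra ℂ (PO n))}
    (e : M.1 ≅ (simple h).1) : HasApexRank M k := fun t => by
  rw [← strict_smul_eq_zero_iff]
  let e' : M.1 ≃ₗ[MonoidAlgebra ℂ (PO n)] (strict n k).Mod := e.toLinearEquiv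
  exact ⟨fun H v => by rw [← e'.apply_symm_apply v, ← map_smul, H, map_zero],
    fun H m => e'.injective (by rw [map_smul, H, map_zero])⟩

theorem eq_of_iso (hk : k ≤ n) (hl : l ≤ n) (e : (simple hk).1 ≅ (simple hl).1) : k = l := by
  let e' : (strict n k).Mod ≃ₗ[MonoidAlgebra ℂ (PO n)] (strict n l).Mod := e.toLinearEquiv
  obtain ⟨f, hf⟩ := exists_coeff_ne_zero
    (e'.map_ne_zero_iff.2 (basisVec_ne_zero (initial hk)))
  exact (eq_of_range_eq (range_eq_of_coeff_ne_zero e'.toLinearMap _ f hf)).symm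

/-- The short exact sequence presenting a simple module by its projective cover. -/
noncomputable def presentation (n k : ℕ) : ShortComplex (ModuleCat.{0} (MonoidAlgebra ℂ (PO n))) :=
  ShortComplex.mk (ModuleCat.ofHom (incl n k)) (ModuleCat.ofHom (proj n k))
    (ModuleCat.hom_ext exact_incl_proj.linearMap_comp_eq_zero)

theorem presentation_shortExact (n k : ℕ) : (presentation n k).ShortExact :=
  ModuleCat.shortComplex_shortExact _ exact_incl_proj incl_injective proj_surjective

theorem extOneDim_simple_eq (hk : k ≤ n) (hl : l ≤ n)
    (h : ∀ φ : (mono n k).Mod →ₗ[MonoidAlgebra ℂ (PO n)] (strict n l).Mod, φ ∘ₗ incl n k = 0) :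
    extOneDim ℂ (simple hk).1 (simple hl).1 =
      Module.rank ℂ (ModuleCat.of (MonoidAlgebra ℂ (PO n)) (degen n k).Mod ⟶ (simple hl).1) := by
  have : Projective (presentation n k).X₂ :=
    (IsProjective.iff_projective (mono n k).Mod).1 (projective_mono hk)
  exact extOneDim_eq_rank_hom ℂ (presentation_shortExact n k) _
    fun φ => ModuleCat.hom_ext (h φ.hom)

/-- A homomorphism from the span of the degenerate `(k + 1)`-tuples to the span of the strictly
increasing `k`-tuples is given by arbitrary scalars, one for each place of the repetition. -/
theorem rank_hom_degen (h : k ≤ n) :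
    Module.rank ℂ (ModuleCat.of (MonoidAlgebra ℂ (PO n)) (degen n (k + 1)).Mod ⟶ (simple h).1) =
      k := by
  classical
  let c (φ : ModuleCat.of (MonoidAlgebra ℂ (PO n)) (degen n (k + 1)).Mod ⟶ (simple h).1)
      (q : Fin k) : ℂ :=
    (strict n k).coeff (initial h) (φ.hom ((degen n (k + 1)).basisVec (repeatAt h q)))
  let L : (ModuleCat.of (MonoidAlgebra ℂ (PO n)) (degen n (k + 1)).Mod ⟶ (simple h).1) →ₗ[ℂ]
      (Fin k → ℂ) :=
    { toFun := c
      map_add' := fun φ ψ => funext fun q => map_add ((strict n k).coeff (initial h)) _ _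
      map_smul' := fun a φ => funext fun q =>
        (congrArg ((strict n k).coeff (initial h)) (algebraMap_smul' a _)).trans
          (map_smul ((strict n k).coeff (initial h)) _ _) }
  have hinj : Function.Injective L := fun φ ψ hφψ => ModuleCat.hom_ext <|
    degen_hom_ext h fun q => by
      have := congrFun hφψ q
      refine (apply_repeatAt h φ.hom q).trans (Eq.trans ?_ (apply_repeatAt h ψ.hom q).symm)
      exact congrArg (· • (strict n k).basisVec (initial h)) this
  have hsurj : Function.Surjective L := by
    rw [← LinearMap.range_eq_top, eq_top_iff, ← (Pi.basisFun ℂ (Fin k)).span_eq,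
      Submodule.span_le]
    rintro _ ⟨q, rfl⟩
    obtain ⟨φ, hφ⟩ := exists_collapse h q
    refine ⟨ModuleCat.ofHom φ, funext fun q' => ?_⟩
    refine (congrArg ((strict n k).coeff (initial h)) (hφ q')).trans ?_
    rw [Pi.basisFun_apply, Pi.single_apply]
    split_ifs with hq
    · rw [coeff_basisVec, if_pos rfl]
    · rw [map_zero]
  rw [(LinearEquiv.ofBijective L ⟨hinj, hsurj⟩).rank_eq, rank_fin_fun]

theorem extOneDim_simple (hk : k ≤ n) (hl : l ≤ n) :
    extOneDim ℂ (simple hk).1 (simple hl).1 = if k = l + 1 then (l : Cardinal) else 0 := by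
  split_ifs with h
  · subst h
    rw [extOneDim_simple_eq hk hl fun φ => ?_, rank_hom_degen]
    rw [mono_hom_eq_zero hk l.succ_ne_self φ, LinearMap.zero_comp]
  · rw [extOneDim_simple_eq hk hl fun φ => degen_hom_eq_zero hk h _]
    have : Subsingleton
        (ModuleCat.of (MonoidAlgebra ℂ (PO n)) (degen n k).Mod ⟶ (simple hl).1) :=
      ⟨fun φ ψ => ModuleCat.hom_ext
        ((degen_hom_eq_zero hk h φ.hom).trans (degen_hom_eq_zero hk h ψ.hom).symm)⟩
    exact rank_subsingleton' _ _

/-- The simple modules spanned by strictly increasing tuples represent every vertex exactly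
once. -/
theorem bijective_mk_simple (n : ℕ) : Function.Bijective fun k : Fin (n + 1) =>
    Vertex.mk (simple (n := n) (Nat.lt_succ_iff.1 k.2)) := by
  constructor
  · intro k l h
    obtain ⟨e⟩ : Nonempty (_ ≅ _) := Quotient.exact h
    exact Fin.ext (eq_of_iso _ _ e)
  · intro V
    induction V using Quotient.inductionOn with
    | h M =>
      have := M.2
      obtain ⟨k, hk, ⟨e⟩⟩ := exists_equiv_strict (n := n) M.1
      exact ⟨⟨k, Nat.lt_succ_iff.2 hk⟩, Quotient.sound ⟨e.toModuleIso⟩⟩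

end TupleClass

theorem mainTheorem6 (n : ℕ) :
    ∃ σ : Fin (n + 1) ≃ OrdinaryQuiver.Vertex (MonoidAlgebra ℂ (PO n)),
      (∀ (k : Fin (n + 1)) (M : OrdinaryQuiver.SimpleModuleCat (MonoidAlgebra ℂ (PO n))),
        OrdinaryQuiver.Vertex.mk M = σ k → HasApexRank M k) ∧
      ∀ i j : Fin (n + 1),
        OrdinaryQuiver.numArrows ℂ (σ i) (σ j) =
          if (i : ℕ) = j + 1 then ((j : ℕ) : Cardinal) else 0 := by
  refine ⟨Equiv.ofBijective _ (TupleClass.bijective_mk_simple n), fun k M hM => ?_, fun i j => ?_⟩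
  · obtain ⟨e⟩ : Nonempty (_ ≅ _) := Quotient.exact hM
    exact TupleClass.hasApexRank_of_iso _ e
  · exact TupleClass.extOneDim_simple _ _
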